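/- Let $n\ge 2$ and let $(a_1,\dots,a_n)$ be a uniformly random permutation of $\{1,\dots,n\}$. Put $p=\min(a_1,a_n)$ and $q=\max(a_1,a_n)$ (the pivots). Among $a_2,\dots,a_{n-1}$ call the elements smaller than $p$ small, those between $p$ and $q$ medium, and those larger than $q$ large; let $s=p-1$ and $\ell=n-q$ be the numbers of small and large elements. A decision tree is a three-way tree with $n-2$ levels of inner nodes in which each inner node $v$ is labelled with an index $i(v)\in\{2,\dots,n-1\}$ and with one of the two pivots, the edges out of $v$ correspond to the outcomes small, medium, large for $a_{i(v)}$, and each index occurs exactly once on each path from the root to a leaf. At node $v$ the element $a_{i(v)}$ is compared first with the pivot in the label, and with the other pivot only if necessary. Let $S_2^T$ be the number of small elements that the tree $T$ compares with $q$ first and $L_2^T$ the number of large elements that it compares with $p$ first. The additional cost term of $T$ is $$\mathrm{ACT}_T=\frac1{\binom n2}\sum_{s+\ell\le n-2}\mathrm E\bigl(S_2^{T}+L_2^{T}\mid s,\ell\bigr);$$ the same definition, with $T=T_{s,\ell}$ in the summand for $(s,\ell)$, applies to strategies that use a tree $T_{s,\ell}$ depending on $s$ and $\ell$. Strategy $\mathcal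 O$ knows $s$ and $\ell$: it inspects the elements in any order, and at a node $v$ with $s_v$ edges labelled small and $\ell_v$ edges labelled large on the path from the root to $v$, it compares with $p$ first if $s-s_v>\ell-\ell_v$, and with $q$ first otherwise. Dual pivot quicksort with a classification strategy returns inputs of length at most $1$ unchanged; otherwise it compares $a_1$ with $a_n$ to find $p$ and $q$, classifies the other elements by the strategy, and recursively sorts the subarrays of small, medium and large elements, each of which is arranged in an order that depends only on the sequence of classification results. The strategy is applied in every recursive call to the respective subarray, with its length and its numbers of small and large elements. Let $\mathrm E(C_n)$ be the average number of key comparisons on a random permutation of $\{1,\dots,n\}$. **Theorem.** Strategy $\mathcal O$ is optimal: for every $n\ge2$, its additional cost term is at most $\mathrm{ACT}_T$ for every single decision tree $T$, and even at most the additional cost term of every choice of trees $(T_{s,\ell})$ depending on $s$ and $\ell$. When $\mathcal O$ is used in dual pivot quicksort, $$\mathrm E(C_n^{\mathcal O})=1.8\,n\ln n+O(n).$$ -/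

import Mathlib

namespace DualPivot

/-- Label of a node: the pivot an element is compared with first
(`p` is the smaller pivot, `q` is the larger pivot). -/
inductive Label
  | p
  | q
  deriving DecidableEq

/-- Result of classifying an element: smaller than `p`, between `p` and `q`, larger than `q`. -/
inductive Kind
  | small
  | medium
  | large
  deriving DecidableEq

/-- Three-way decision trees that classify the elements at the positions in `I`. Each inner node
carries the position to be classified and the pivot to be used first, and has one child for each
outcome. Along each path from the root to a leaf every position in `I` occurs exactly once. -/
inductive DecisionTree : Finset ℕ → Type
  | leaf : DecisionTree ∅
  | node {I : Finset ℕ} (i : ℕ) (hi : i ∈ I) (l : Label)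
      (child : Kind → DecisionTree (I.erase i)) : DecisionTree I

/-- The path in the tree of an input whose element at position `i` has kind `c i`: the list of
position, node label and edge label on each level. -/
def DecisionTree.path (c : ℕ → Kind) : {I : Finset ℕ} → DecisionTree I → List (ℕ × Label × Kind)
  | _, .leaf => []
  | _, .node i _ l child => (i, l, c i) :: (child (c i)).path c

/-- Number of comparisons with the pivots needed to classify an element of the given kind, when it
is compared first with the given pivot, and with the other pivot only if this is not yet
conclusive. -/
def comparisons : Label → Kind → ℕ
  | .p, .small => 1
  | .q, .large => 1
  | _, _ => 2

/-- Number of small elements that are compared with the larger pivot first. -/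
def DecisionTree.S₂ {I : Finset ℕ} (t : DecisionTree I) (c : ℕ → Kind) : ℕ :=
  (t.path c).countP fun x => decide (x.2.1 = Label.q ∧ x.2.2 = Kind.small)

/-- Number of large elements that are compared with the smaller pivot first. -/
def DecisionTree.L₂ {I : Finset ℕ} (t : DecisionTree I) (c : ℕ → Kind) : ℕ :=
  (t.path c).countP fun x => decide (x.2.1 = Label.p ∧ x.2.2 = Kind.large)

/-- Positions of the non-pivot elements in an input `a₁, …, aₙ` with pivots `a₁` and `aₙ`. -/
abbrev inner (n : ℕ) : Finset ℕ := Finset.Icc 2 (n - 1)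

/-- The element `aᵢ` of the input `a₁, …, aₙ` (positions are counted from 1). -/
def entry (a : List ℕ) (i : ℕ) : ℕ := a.getD (i - 1) 0

/-- The smaller one of the two pivots `a₁` and `aₙ`. -/
def pivotP (a : List ℕ) : ℕ := min (entry a 1) (entry a a.length)

/-- The larger one of the two pivots `a₁` and `aₙ`. -/
def pivotQ (a : List ℕ) : ℕ := max (entry a 1) (entry a a.length)

/-- The kind of the element `aᵢ` with respect to the pivots. -/
def kind (a : List ℕ) (i : ℕ) : Kind :=
  if entry a i < pivotP a then .small else if pivotQ a < entry a i then .large else .medium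

/-- The kinds of `a₂, …, aₙ₋₁`, in this order. -/
def kinds (a : List ℕ) : List Kind := (List.range' 2 (a.length - 2)).map (kind a)

/-- The number `s` of small elements. -/
def numSmall (a : List ℕ) : ℕ := (kinds a).count .small

/-- The number `ℓ` of large elements. -/
def numLarge (a : List ℕ) : ℕ := (kinds a).count .large

/-- A classification strategy that may know `n`, `s` and `ℓ`: one decision tree for each choice
of these numbers. -/
abbrev Strategy : Type := (n : ℕ) → (s : ℕ) → (l : ℕ) → DecisionTree (inner n)

/-- In the subtree given as last argument, whose root `v` has `sv` edges labelled "small" and `lv`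
edges labelled "large" above it, each node is labelled by the rule: the smaller pivot first if
`s - sv > l - lv`, otherwise the larger pivot first. -/
def FollowsO (s l : ℕ) : (sv lv : ℕ) → {I : Finset ℕ} → DecisionTree I → Prop
  | _, _, _, .leaf => True
  | sv, lv, _, .node _ _ lab child =>
      (lab = Label.p ↔ (s : ℤ) - sv > (l : ℤ) - lv) ∧
      FollowsO s l (sv + 1) lv (child .small) ∧
      FollowsO s l sv lv (child .medium) ∧
      FollowsO s l sv (lv + 1) (child .large)

/-- `S` is Strategy O; the order in which the elements are inspected is arbitrary. -/
def IsStrategyO (S : Strategy) : Prop :=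
  ∀ n s l : ℕ, s + l + 2 ≤ n → FollowsO s l 0 0 (S n s l)

/-- The permutation `σ` as an input sequence `(a₁, …, aₙ)` with entries `1, …, n`. -/
def toInput {n : ℕ} (σ : Equiv.Perm (Fin n)) : List ℕ := List.ofFn fun i => (σ i : ℕ) + 1

/-- `E(S₂ + L₂ ∣ s, ℓ)` for the tree `T` and a uniformly random permutation of `1, …, n`. -/
noncomputable def condExpAdditional (n : ℕ) (T : DecisionTree (inner n)) (s l : ℕ) : ℝ :=
  let Ω := (Finset.univ : Finset (Equiv.Perm (Fin n))).filter
    fun σ => numSmall (toInput σ) = s ∧ numLarge (toInput σ) = l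
  (∑ σ ∈ Ω, ((T.S₂ (kind (toInput σ)) + T.L₂ (kind (toInput σ)) : ℕ) : ℝ)) / (Ω.card : ℝ)

/-- The additional cost term on inputs of length `n`, when the tree `T s l` is used for `s` small
and `l` large elements. For a single tree, `T` is constant. -/
noncomputable def ACT (n : ℕ) (T : ℕ → ℕ → DecisionTree (inner n)) : ℝ :=
  (∑ x ∈ (Finset.range (n - 1) ×ˢ Finset.range (n - 1)).filter (fun x => x.1 + x.2 ≤ n - 2),
    condExpAdditional n (T x.1 x.2) x.1 x.2) / (n.choose 2 : ℝ)

/-- A way of moving the elements after (or while) classifying them: for each sequence `w` of kinds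
of `a₂, …, aₙ₋₁` and each kind `k`, the order in which the elements of kind `k` are arranged in
their subarray, given by their original positions. No key comparisons are used. -/
structure Arrangement where
  order : List Kind → Kind → List ℕ
  perm : ∀ w k,
    (order w k).Perm ((List.range' 2 w.length).filter fun i => decide (w[i - 2]? = some k))

/-- The subarray of the elements of kind `k` after the partitioning step. -/
def subarray (A : Arrangement) (a : List ℕ) (k : Kind) : List ℕ :=
  (A.order (kinds a) k).map (entry a)

theorem length_subarray_lt (A : Arrangement) (a : List ℕ) (k : Kind) (h : ¬ a.length ≤ 1) :
    (subarray A a k).length < a.length := by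
  have h1 := (A.perm (kinds a) k).length_eq
  have h2 := List.length_filter_le
    (fun i => decide ((kinds a)[i - 2]? = some k)) (List.range' 2 (kinds a).length)
  simp only [List.length_range', kinds, List.length_map] at h1 h2
  simp only [subarray, kinds, List.length_map]
  omega

/-- Dual pivot quicksort with classification strategy `S`. It returns the sorted sequence and the
number of key comparisons: one for the two pivots, those for classifying the other elements by
the tree `S n s l`, and those of the three recursive calls. -/
def quicksort (S : Strategy) (A : Arrangement) (a : List ℕ) : List ℕ × ℕ :=
  if h : a.length ≤ 1 then (a, 0)
  else
    let t := S a.length (numSmall a) (numLarge a)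
    let cost := ((t.path (kind a)).map fun x => comparisons x.2.1 x.2.2).sum
    let r₁ := quicksort S A (subarray A a .small)
    let r₂ := quicksort S A (subarray A a .medium)
    let r₃ := quicksort S A (subarray A a .large)
    (r₁.1 ++ pivotP a :: (r₂.1 ++ pivotQ a :: r₃.1), 1 + cost + r₁.2 + r₂.2 + r₃.2)
termination_by a.length
decreasing_by all_goals exact length_subarray_lt A a _ h

/-- `E(Cₙ)`: the average number of key comparisons of dual pivot quicksort over all permutations
of `1, …, n`. -/
noncomputable def expComparisons (S : Strategy) (A : Arrangement) (n : ℕ) : ℝ :=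
  (∑ σ : Equiv.Perm (Fin n), ((quicksort S A (toInput σ)).2 : ℝ)) / (n.factorial : ℝ)

end DualPivot

/-!
Let `s` and `l` be the numbers of small and large elements among the `N = n - 2` elements that are
not pivots.

*Optimality.* Given `s` and `l`, the kinds of the elements at the inner positions form an
exchangeable family, and this property survives conditioning on the kind of one element. So whatever
a tree does, the next element is small with probability `s / N` and large with probability `l / N`,
and the label of the node makes an additional comparison necessary with probability `s / N` (label
`q`) or `l / N` (label `p`). Induction on the tree shows that no tree beats the function
`minAdditional`, in which each step contributes `min s l / N` (`le_sum_additional`), and that a tree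
following Strategy O attains it (`sum_additional_of_followsO`).

*Average cost.* The symmetries that permute values show that all pairs `(s, l)` with `s + l ≤ N` are
equally likely (`card_sample_mul`) and that the subarrays are random permutations again
(`sum_subarray`). This gives the recurrence `expComparisons_recurrence`.
A uniformly distributed pair `(s, l)` remains uniformly distributed when an element is removed at
random (`sumAdditional_succ`). Hence the expected number of additional comparisons for `N` elements
is the sum, over `1 ≤ M ≤ N`, of the mean of `min s l / M` on the simplex `s + l ≤ M`. This mean is
`1 / 6 + O(1 / M)`, so that the additional comparisons number `N / 6 + O(log N)` and one
partitioning step takes `3 n / 2 + O(log n)` comparisons on average. With harmonic numbers `H n` the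
recurrence operator can be evaluated exactly on `n * H n`, `H n` and `n`. A comparison principle
(`le_of_recurrence`) then confines the average cost between `9 / 5 * (n + 1) * H n - 4 * n` and
`9 / 5 * (n + 1) * H n`.
-/

namespace DualPivot

/-! ### Decision trees on exchangeable inputs -/

/-- The additional comparison made for an element of kind `k` at a node with label `l`: one if the
first comparison is with the pivot on the wrong side, otherwise none. -/
def extra (l : Label) (k : Kind) : ℕ :=
  (if l = .q ∧ k = .small then 1 else 0) + (if l = .p ∧ k = .large then 1 else 0)

/-- The number `S₂ + L₂` of additional comparisons of a tree on the input with kinds `c`. -/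
def DecisionTree.additional {I : Finset ℕ} (t : DecisionTree I) (c : ℕ → Kind) : ℕ :=
  t.S₂ c + t.L₂ c

@[simp] theorem additional_leaf (c : ℕ → Kind) : DecisionTree.leaf.additional c = 0 := rfl

theorem additional_node {I : Finset ℕ} (i : ℕ) (hi : i ∈ I) (l : Label)
    (child : Kind → DecisionTree (I.erase i)) (c : ℕ → Kind) :
    (DecisionTree.node i hi l child).additional c = extra l (c i) + (child (c i)).additional c := by
  simp only [DecisionTree.additional, DecisionTree.S₂, DecisionTree.L₂, DecisionTree.path, extra,
    List.countP_cons, decide_eq_true_eq]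
  omega

theorem card_filter_erase {I : Finset ℕ} {i : ℕ} (hi : i ∈ I) (c : ℕ → Kind) (k : Kind) :
    ((I.erase i).filter fun j => c j = k).card =
      (I.filter fun j => c j = k).card - if c i = k then 1 else 0 := by
  rw [Finset.filter_erase]
  split_ifs with h
  · rw [Finset.card_erase_of_mem (by simp [hi, h])]
  · rw [Finset.erase_eq_of_notMem (by simp [h])]; simp

theorem path_congr {I : Finset ℕ} (t : DecisionTree I) {c c' : ℕ → Kind}
    (h : ∀ i ∈ I, c i = c' i) : t.path c = t.path c' := by
  induction t with
  | leaf => rfl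
  | node i hi l child ih =>
    simp only [DecisionTree.path]
    rw [h i hi, ih (c' i) fun j hj => h j (Finset.mem_of_mem_erase hj)]

theorem sum_comparisons_path {I : Finset ℕ} (t : DecisionTree I) (c : ℕ → Kind) :
    ((t.path c).map fun x => comparisons x.2.1 x.2.2).sum =
      I.card + (I.filter fun i => c i = .medium).card + t.additional c := by
  induction t with
  | leaf => rfl
  | @node I i hi l child ih =>
    have h1 := card_filter_erase hi c .medium
    have h2 := Finset.card_erase_add_one hi
    have h3 : c i = .medium → 0 < (I.filter fun i => c i = .medium).card := fun h =>
      Finset.card_pos.2 ⟨i, by simp [hi, h]⟩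
    rw [additional_node]
    simp only [DecisionTree.path, List.map_cons, List.sum_cons, ih]
    have h4 : comparisons l (c i) = 1 + (if c i = .medium then 1 else 0) + extra l (c i) := by
      cases l <;> cases c i <;> rfl
    rw [h4, h1]
    split_ifs with h
    · have := h3 h; omega
    · omega

/-- A finite family `X` of inputs, given by the kinds `c x` of their elements, is exchangeable on
`I` if exchanging two positions in `I` permutes the family. -/
def Exchangeable {α : Type*} (X : Finset α) (c : α → ℕ → Kind) (I : Finset ℕ) : Prop :=
  ∀ i ∈ I, ∀ j ∈ I, ∃ e : Equiv.Perm α, (∀ x, e x ∈ X ↔ x ∈ X) ∧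
    ∀ x ∈ X, ∀ k, c (e x) k = c x (Equiv.swap i j k)

section

variable {α : Type*} {X : Finset α} {c : α → ℕ → Kind} {I : Finset ℕ}

/-- Classifying one element leaves an exchangeable family on the remaining positions. -/
theorem Exchangeable.filter (h : Exchangeable X c I) (i : ℕ) (k : Kind) :
    Exchangeable (X.filter fun x => c x i = k) c (I.erase i) := by
  intro a ha b hb
  obtain ⟨e, he, hc⟩ := h a (Finset.mem_of_mem_erase ha) b (Finset.mem_of_mem_erase hb)
  refine ⟨e, fun x => ?_, fun x hx => hc x (Finset.mem_of_mem_filter x hx)⟩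
  simp only [Finset.mem_filter, he]
  refine and_congr_right fun hx => ?_
  rw [hc x hx, Equiv.swap_apply_of_ne_of_ne (Finset.ne_of_mem_erase ha).symm
    (Finset.ne_of_mem_erase hb).symm]

/-- In an exchangeable family each position has kind `k` equally often, namely in a fraction
`s / |I|` of the inputs if each input has `s` elements of kind `k`. -/
theorem Exchangeable.card_filter_mul (h : Exchangeable X c I) {k : Kind} {s : ℕ}
    (hs : ∀ x ∈ X, (I.filter fun i => c x i = k).card = s) {i : ℕ} (hi : i ∈ I) :
    (X.filter fun x => c x i = k).card * I.card = s * X.card := by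
  have h1 : ∀ j ∈ I, (X.filter fun x => c x j = k).card = (X.filter fun x => c x i = k).card := by
    intro j hj
    obtain ⟨e, he, hc⟩ := h i hi j hj
    refine Finset.card_bij' (fun x _ => e x) (fun x _ => e.symm x) ?_ ?_ (by simp) (by simp)
    · intro x hx
      rw [Finset.mem_filter] at hx ⊢
      rw [he, hc x hx.1, Equiv.swap_apply_left]
      exact hx
    · intro x hx
      rw [Finset.mem_filter] at hx ⊢
      have h2 : e.symm x ∈ X := by rw [← he]; simpa using hx.1
      have h3 := hc _ h2 i
      rw [Equiv.swap_apply_left, Equiv.apply_symm_apply] at h3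
      exact ⟨h2, h3 ▸ hx.2⟩
  have h2 := Finset.sum_card_bipartiteAbove_eq_sum_card_bipartiteBelow
    (s := X) (t := I) (r := fun x j => c x j = k)
  simp only [Finset.bipartiteAbove, Finset.bipartiteBelow] at h2
  rw [Finset.sum_congr rfl hs, Finset.sum_congr rfl h1] at h2
  simp only [Finset.sum_const, smul_eq_mul] at h2
  linarith

/-- The least possible expected number of additional comparisons for classifying `N` elements, of
which `s` are small and `l` are large, when all arrangements are equally likely. The next element
costs an additional comparison with probability at least `min s l / N`. -/
noncomputable def minAdditional : ℕ → ℕ → ℕ → ℝ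
  | 0, _, _ => 0
  | N + 1, s, l => (min (s : ℝ) l + s * minAdditional N (s - 1) l + l * minAdditional N s (l - 1) +
      ((N : ℝ) + 1 - s - l) * minAdditional N s l) / (N + 1)

theorem sum_additional_node (i : ℕ) (hi : i ∈ I) (lab : Label)
    (child : Kind → DecisionTree (I.erase i)) :
    ∑ x ∈ X, (DecisionTree.node i hi lab child).additional (c x) =
      (if lab = .q then (X.filter fun x => c x i = .small).card
        else (X.filter fun x => c x i = .large).card) +
      ((∑ x ∈ X with c x i = .small, (child .small).additional (c x)) +
        (∑ x ∈ X with c x i = .medium, (child .medium).additional (c x)) +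
        ∑ x ∈ X with c x i = .large, (child .large).additional (c x)) := by
  simp only [additional_node, Finset.sum_filter, Finset.card_filter, Finset.sum_add_distrib]
  have h1 : ∑ x ∈ X, extra lab (c x i) = if lab = .q then ∑ x ∈ X, (if c x i = .small then 1 else 0)
      else ∑ x ∈ X, (if c x i = .large then 1 else 0) := by
    cases lab <;> simp [extra]
  rw [h1, ← Finset.sum_add_distrib, ← Finset.sum_add_distrib]
  congr 1
  refine Finset.sum_congr rfl fun x _ => ?_
  cases h : c x i <;> simp

/-- The inputs with each of the three kinds at a given position, as fractions of an exchangeable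
family, together with the numbers of small and large elements among the remaining positions. -/
theorem Exchangeable.split {s l N : ℕ} (h : Exchangeable X c I)
    (hs : ∀ x ∈ X, (I.filter fun i => c x i = .small).card = s)
    (hl : ∀ x ∈ X, (I.filter fun i => c x i = .large).card = l) (hN : I.card = N + 1)
    {i : ℕ} (hi : i ∈ I) :
    ((X.filter fun x => c x i = .small).card : ℝ) = s * X.card / (N + 1) ∧
    ((X.filter fun x => c x i = .large).card : ℝ) = l * X.card / (N + 1) ∧
    ((X.filter fun x => c x i = .medium).card : ℝ) = (N + 1 - s - l) * X.card / (N + 1) := by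
  have h1 := h.card_filter_mul hs hi
  have h2 := h.card_filter_mul hl hi
  have h3 : (X.filter fun x => c x i = .small).card + (X.filter fun x => c x i = .medium).card +
      (X.filter fun x => c x i = .large).card = X.card := by
    simp only [Finset.card_filter, ← Finset.sum_add_distrib, Finset.card_eq_sum_ones X]
    refine Finset.sum_congr rfl fun x _ => ?_
    cases c x i <;> simp
  rw [hN] at h1 h2
  have h1' : ((X.filter fun x => c x i = .small).card : ℝ) * (N + 1) = s * X.card := by
    exact_mod_cast h1
  have h2' : ((X.filter fun x => c x i = .large).card : ℝ) * (N + 1) = l * X.card := by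
    exact_mod_cast h2
  have h3' : ((X.filter fun x => c x i = .small).card : ℝ) +
      (X.filter fun x => c x i = .medium).card + (X.filter fun x => c x i = .large).card =
        X.card := by
    exact_mod_cast h3
  have hN0 : (N : ℝ) + 1 ≠ 0 := by positivity
  refine ⟨?_, ?_, ?_⟩ <;> rw [eq_div_iff hN0]
  · exact h1'
  · exact h2'
  · linear_combination (N + 1 : ℝ) * h3' - h1' - h2'

/-- No tree makes fewer additional comparisons on an exchangeable family than `minAdditional`. -/
theorem le_sum_additional (t : DecisionTree I) : ∀ {X : Finset α} {s l : ℕ},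
    Exchangeable X c I → (∀ x ∈ X, (I.filter fun i => c x i = .small).card = s) →
    (∀ x ∈ X, (I.filter fun i => c x i = .large).card = l) →
    X.card * minAdditional I.card s l ≤ ((∑ x ∈ X, t.additional (c x) : ℕ) : ℝ) := by
  induction t with
  | leaf => intros; simp [minAdditional]
  | @node I i hi lab child ih =>
    intro X s l h hs hl
    have hN : I.card = (I.erase i).card + 1 := (Finset.card_erase_add_one hi).symm
    have hsub : ∀ k, ∀ x ∈ X.filter fun x => c x i = k, x ∈ X ∧ c x i = k := by simp
    have e1 := ih .small (X := X.filter fun x => c x i = .small) (s := s - 1) (l := l)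
      (h.filter i _)
      (fun x hx => by rw [card_filter_erase hi, hs x (hsub _ x hx).1]; simp [(hsub _ x hx).2])
      (fun x hx => by rw [card_filter_erase hi, hl x (hsub _ x hx).1]; simp [(hsub _ x hx).2])
    have e2 := ih .medium (X := X.filter fun x => c x i = .medium) (s := s) (l := l) (h.filter i _)
      (fun x hx => by rw [card_filter_erase hi, hs x (hsub _ x hx).1]; simp [(hsub _ x hx).2])
      (fun x hx => by rw [card_filter_erase hi, hl x (hsub _ x hx).1]; simp [(hsub _ x hx).2])
    have e3 := ih .large (X := X.filter fun x => c x i = .large) (s := s) (l := l - 1)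
      (h.filter i _)
      (fun x hx => by rw [card_filter_erase hi, hs x (hsub _ x hx).1]; simp [(hsub _ x hx).2])
      (fun x hx => by rw [card_filter_erase hi, hl x (hsub _ x hx).1]; simp [(hsub _ x hx).2])
    obtain ⟨c1, c2, c3⟩ := h.split hs hl hN hi
    rw [sum_additional_node, hN, minAdditional]
    push_cast at e1 e2 e3 ⊢
    rw [c1] at e1
    rw [c3] at e2
    rw [c2] at e3
    rw [c1, c2]
    have hmin : min (s : ℝ) l * X.card / ((I.erase i).card + 1) ≤
        if lab = .q then (s : ℝ) * X.card / ((I.erase i).card + 1)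
          else (l : ℝ) * X.card / ((I.erase i).card + 1) := by
      split_ifs
      · gcongr; exact min_le_left _ _
      · gcongr; exact min_le_right _ _
    refine le_trans (le_of_eq ?_) (add_le_add hmin (add_le_add (add_le_add e1 e2) e3))
    field_simp
    ring

/-- Strategy O attains the minimum on an exchangeable family: comparing with the pivot on the side
of the majority of the remaining non-medium elements is the cheaper choice at every node. -/
theorem sum_additional_of_followsO {s₀ l₀ : ℕ} (t : DecisionTree I) :
    ∀ {X : Finset α} {s l sv lv : ℕ}, FollowsO s₀ l₀ sv lv t → s + sv = s₀ → l + lv = l₀ →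
    Exchangeable X c I → (∀ x ∈ X, (I.filter fun i => c x i = .small).card = s) →
    (∀ x ∈ X, (I.filter fun i => c x i = .large).card = l) →
    ((∑ x ∈ X, t.additional (c x) : ℕ) : ℝ) = X.card * minAdditional I.card s l := by
  induction t with
  | leaf => intros; simp [minAdditional]
  | @node I i hi lab child ih =>
    intro X s l sv lv hO hs0 hl0 h hs hl
    obtain ⟨hlab, hO1, hO2, hO3⟩ := hO
    have hN : I.card = (I.erase i).card + 1 := (Finset.card_erase_add_one hi).symm
    have hsub : ∀ k, ∀ x ∈ X.filter fun x => c x i = k, x ∈ X ∧ c x i = k := by simp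
    have e1 : ((∑ x ∈ X with c x i = .small, (child .small).additional (c x) : ℕ) : ℝ) =
        (X.filter fun x => c x i = .small).card * minAdditional (I.erase i).card (s - 1) l := by
      rcases (X.filter fun x => c x i = .small).eq_empty_or_nonempty with he | ⟨x, hx⟩
      · simp [he]
      have : 0 < s := by
        rw [← hs x (hsub _ x hx).1]
        exact Finset.card_pos.2 ⟨i, by simp [hi, (hsub _ x hx).2]⟩
      exact ih .small hO1 (by omega) hl0 (h.filter i _)
        (fun x hx => by rw [card_filter_erase hi, hs x (hsub _ x hx).1]; simp [(hsub _ x hx).2])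
        (fun x hx => by rw [card_filter_erase hi, hl x (hsub _ x hx).1]; simp [(hsub _ x hx).2])
    have e2 := ih .medium (X := X.filter fun x => c x i = .medium) hO2 hs0 hl0 (h.filter i _)
      (fun x hx => by rw [card_filter_erase hi, hs x (hsub _ x hx).1]; simp [(hsub _ x hx).2])
      (fun x hx => by rw [card_filter_erase hi, hl x (hsub _ x hx).1]; simp [(hsub _ x hx).2])
    have e3 : ((∑ x ∈ X with c x i = .large, (child .large).additional (c x) : ℕ) : ℝ) =
        (X.filter fun x => c x i = .large).card * minAdditional (I.erase i).card s (l - 1) := by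
      rcases (X.filter fun x => c x i = .large).eq_empty_or_nonempty with he | ⟨x, hx⟩
      · simp [he]
      have : 0 < l := by
        rw [← hl x (hsub _ x hx).1]
        exact Finset.card_pos.2 ⟨i, by simp [hi, (hsub _ x hx).2]⟩
      exact ih .large hO3 hs0 (by omega) (h.filter i _)
        (fun x hx => by rw [card_filter_erase hi, hs x (hsub _ x hx).1]; simp [(hsub _ x hx).2])
        (fun x hx => by rw [card_filter_erase hi, hl x (hsub _ x hx).1]; simp [(hsub _ x hx).2])
    obtain ⟨c1, c2, c3⟩ := h.split hs hl hN hi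
    rw [sum_additional_node, hN, minAdditional]
    push_cast at e1 e2 e3 ⊢
    rw [e1, e2, e3, c1, c2, c3]
    have hmin : (if lab = .q then (s : ℝ) * X.card / ((I.erase i).card + 1)
          else (l : ℝ) * X.card / ((I.erase i).card + 1)) =
        min (s : ℝ) l * X.card / ((I.erase i).card + 1) := by
      cases lab with
      | p =>
        have : l ≤ s := by have := hlab.1 rfl; omega
        simp [min_eq_right (Nat.cast_le.2 this)]
      | q =>
        have : s ≤ l := by
          by_contra hc
          exact absurd (hlab.2 (by omega)) (by simp)
        simp [min_eq_left (Nat.cast_le.2 this)]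
    rw [hmin]
    field_simp
    ring

end

theorem exists_followsO (s l : ℕ) (I : Finset ℕ) :
    ∀ sv lv, ∃ t : DecisionTree I, FollowsO s l sv lv t := by
  induction h : I.card generalizing I with
  | zero =>
    intro sv lv
    obtain rfl := Finset.card_eq_zero.1 h
    exact ⟨.leaf, trivial⟩
  | succ N ih =>
    intro sv lv
    obtain ⟨i, hi⟩ := Finset.card_pos.1 (show 0 < I.card by omega)
    have ih' := ih (I.erase i) (by rw [Finset.card_erase_of_mem hi, h]; rfl)
    obtain ⟨t₁, h₁⟩ := ih' (sv + 1) lv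
    obtain ⟨t₂, h₂⟩ := ih' sv lv
    obtain ⟨t₃, h₃⟩ := ih' sv (lv + 1)
    classical
    refine ⟨.node i hi (if (s : ℤ) - sv > (l : ℤ) - lv then .p else .q)
      (fun | .small => t₁ | .medium => t₂ | .large => t₃), ?_, h₁, h₂, h₃⟩
    split_ifs with hc <;> simp [hc]

theorem exists_isStrategyO : ∃ S : Strategy, IsStrategyO S := by
  choose S hS using fun n s l => exists_followsO s l (inner n) 0 0
  exact ⟨S, fun n s l _ => hS n s l⟩

/-! ### Relabelling the elements of an input -/

theorem entry_map (f : ℕ → ℕ) {a : List ℕ} {i : ℕ} (hi : i - 1 < a.length) :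
    entry (a.map f) i = f (entry a i) := by
  simp [entry, List.getD_eq_getElem?_getD, hi]

theorem getElem?_kinds (a : List ℕ) {i : ℕ} (h1 : 2 ≤ i) (h2 : i < 2 + (a.length - 2)) :
    (kinds a)[i - 2]? = some (kind a i) := by
  rw [kinds, List.getElem?_map, List.getElem?_range' (by omega)]
  simp only [Option.map_some, Option.some.injEq]
  congr 1; omega

theorem mem_order (A : Arrangement) (a : List ℕ) (k : Kind) (i : ℕ) :
    i ∈ A.order (kinds a) k ↔ i ∈ inner a.length ∧ kind a i = k := by
  have hl : (kinds a).length = a.length - 2 := by simp [kinds]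
  rw [(A.perm (kinds a) k).mem_iff, List.mem_filter, List.mem_range'_1, decide_eq_true_eq, hl,
    Finset.mem_Icc]
  constructor
  · rintro ⟨⟨h1, h2⟩, h⟩
    rw [getElem?_kinds a h1 h2, Option.some.injEq] at h
    exact ⟨by omega, h⟩
  · rintro ⟨⟨h1, h2⟩, h⟩
    rw [getElem?_kinds a h1 (by omega), Option.some.injEq]
    exact ⟨by omega, h⟩

theorem nodup_order (A : Arrangement) (w : List Kind) (k : Kind) : (A.order w k).Nodup :=
  (A.perm w k).nodup_iff.2 (List.Nodup.filter _ List.nodup_range')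

theorem count_kinds (a : List ℕ) (k : Kind) :
    (kinds a).count k = ((inner a.length).filter fun i => kind a i = k).card := by
  rw [kinds, List.count_eq_countP, List.countP_map, List.countP_eq_length_filter,
    ← List.toFinset_card_of_nodup (List.Nodup.filter _ List.nodup_range')]
  congr 1
  ext i
  simp only [List.mem_toFinset, List.mem_filter, List.mem_range'_1, Function.comp, beq_iff_eq,
    Finset.mem_filter, Finset.mem_Icc]
  refine and_congr_left fun _ => ?_
  omega

theorem subarray_map (A : Arrangement) (f : ℕ → ℕ) {a : List ℕ} (k : Kind)
    (h : kinds (a.map f) = kinds a) : subarray A (a.map f) k = (subarray A a k).map f := by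
  rw [subarray, subarray, h, List.map_map]
  refine List.map_congr_left fun i hi => ?_
  have := ((mem_order A a k i).1 hi).1
  rw [Finset.mem_Icc] at this
  exact entry_map f (by omega)

theorem kind_map_add (d : ℕ) {a : List ℕ} {i : ℕ} (hi : i ∈ inner a.length) :
    kind (a.map (· + d)) i = kind a i := by
  rw [Finset.mem_Icc] at hi
  have hp : pivotP (a.map (· + d)) = pivotP a + d := by
    rw [pivotP, pivotP, List.length_map, entry_map _ (by omega), entry_map _ (by omega)]
    exact min_add_add_right ..
  have hq : pivotQ (a.map (· + d)) = pivotQ a + d := by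
    rw [pivotQ, pivotQ, List.length_map, entry_map _ (by omega), entry_map _ (by omega)]
    exact max_add_add_right ..
  have he : entry (a.map (· + d)) i = entry a i + d := entry_map _ (by omega)
  simp only [kind, hp, hq, he, Nat.add_lt_add_iff_right]

theorem kinds_map_add (d : ℕ) (a : List ℕ) : kinds (a.map (· + d)) = kinds a := by
  rw [kinds, kinds, List.length_map]
  refine List.map_congr_left fun i hi => kind_map_add d ?_
  rw [List.mem_range'_1] at hi
  rw [Finset.mem_Icc]
  omega

/-- The number of comparisons made for classifying the elements of `a` in a call of quicksort. -/
def partitionCost (S : Strategy) (a : List ℕ) : ℕ :=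
  (((S a.length (numSmall a) (numLarge a)).path (kind a)).map fun x => comparisons x.2.1 x.2.2).sum

theorem quicksort_snd (S : Strategy) (A : Arrangement) {a : List ℕ} (h : ¬ a.length ≤ 1) :
    (quicksort S A a).2 = 1 + partitionCost S a + (quicksort S A (subarray A a .small)).2 +
      (quicksort S A (subarray A a .medium)).2 + (quicksort S A (subarray A a .large)).2 := by
  rw [quicksort, dif_neg h]
  rfl

theorem quicksort_snd_of_le (S : Strategy) (A : Arrangement) {a : List ℕ} (h : a.length ≤ 1) :
    (quicksort S A a).2 = 0 := by
  rw [quicksort, dif_pos h]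

theorem partitionCost_eq (S : Strategy) {a : List ℕ} {n : ℕ} (h : a.length = n) :
    partitionCost S a = (inner n).card + (kinds a).count .medium +
      (S n (numSmall a) (numLarge a)).additional (kind a) := by
  subst h
  rw [partitionCost, sum_comparisons_path, count_kinds]

theorem additional_congr {I : Finset ℕ} (t : DecisionTree I) {c c' : ℕ → Kind}
    (h : ∀ i ∈ I, c i = c' i) : t.additional c = t.additional c' := by
  simp only [DecisionTree.additional, DecisionTree.S₂, DecisionTree.L₂, path_congr t h]

/-- The cost of sorting an input depends only on the relative order of its elements; it suffices
to know this for translations, since subarrays of permutations consist of consecutive numbers. -/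
theorem quicksort_snd_map_add (S : Strategy) (A : Arrangement) (d : ℕ) (a : List ℕ) :
    (quicksort S A (a.map (· + d))).2 = (quicksort S A a).2 := by
  induction h : a.length using Nat.strong_induction_on generalizing a with
  | _ n ih =>
    subst h
    by_cases h1 : a.length ≤ 1
    · rw [quicksort_snd_of_le S A h1, quicksort_snd_of_le S A (by simpa using h1)]
    · rw [quicksort_snd S A h1, quicksort_snd S A (a := a.map (· + d)) (by simpa using h1)]
      have hk := kinds_map_add d a
      have h2 : partitionCost S (a.map (· + d)) = partitionCost S a := by
        rw [partitionCost_eq S (List.length_map _), partitionCost_eq S rfl, numSmall, numLarge, hk,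
          additional_congr _ fun i hi => kind_map_add d hi]
        rfl
      simp only [h2, subarray_map A _ _ hk]
      rw [ih _ (length_subarray_lt A a .small h1) _ rfl,
        ih _ (length_subarray_lt A a .medium h1) _ rfl,
        ih _ (length_subarray_lt A a .large h1) _ rfl]

/-! ### Random permutations -/

@[simp] theorem length_toInput {n : ℕ} (σ : Equiv.Perm (Fin n)) : (toInput σ).length = n := by
  simp [toInput]

theorem entry_toInput {n : ℕ} (σ : Equiv.Perm (Fin n)) {i : ℕ} (hi : i - 1 < n) :
    entry (toInput σ) i = σ ⟨i - 1, hi⟩ + 1 := by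
  simp [entry, toInput, List.getD_eq_getElem?_getD, hi]

theorem entry_toInput_of_le {n : ℕ} (σ : Equiv.Perm (Fin n)) {i : ℕ} (hi : n ≤ i - 1) :
    entry (toInput σ) i = 0 := by
  simp [entry, toInput, List.getD_eq_getElem?_getD, hi]

/-- The smaller pivot of a permutation of `0, …, N + 1`. -/
def lowPivot {N : ℕ} (σ : Equiv.Perm (Fin (N + 2))) : ℕ := min (σ 0) (σ (Fin.last _))

/-- The larger pivot of a permutation of `0, …, N + 1`. -/
def highPivot {N : ℕ} (σ : Equiv.Perm (Fin (N + 2))) : ℕ := max (σ 0) (σ (Fin.last _))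

theorem lowPivot_congr {N : ℕ} {σ ρ : Equiv.Perm (Fin (N + 2))} (h : σ 0 = ρ 0 ∧
    σ (Fin.last _) = ρ (Fin.last _)) : lowPivot σ = lowPivot ρ := by
  rw [lowPivot, h.1, h.2, lowPivot]

theorem highPivot_congr {N : ℕ} {σ ρ : Equiv.Perm (Fin (N + 2))} (h : σ 0 = ρ 0 ∧
    σ (Fin.last _) = ρ (Fin.last _)) : highPivot σ = highPivot ρ := by
  rw [highPivot, h.1, h.2, highPivot]

theorem lowPivot_lt_highPivot {N : ℕ} (σ : Equiv.Perm (Fin (N + 2))) :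
    lowPivot σ < highPivot σ := by
  have h : σ 0 ≠ σ (Fin.last _) := fun h => absurd (σ.injective h) (Fin.last_pos).ne
  have h' : (σ 0 : ℕ) ≠ σ (Fin.last _) := fun hc => h (Fin.ext hc)
  simp only [lowPivot, highPivot]; omega

theorem highPivot_lt {N : ℕ} (σ : Equiv.Perm (Fin (N + 2))) : highPivot σ < N + 2 := by
  simp only [highPivot]; omega

theorem pivotP_toInput {N : ℕ} (σ : Equiv.Perm (Fin (N + 2))) :
    pivotP (toInput σ) = lowPivot σ + 1 := by
  rw [pivotP, length_toInput, entry_toInput σ (by omega), entry_toInput σ (by omega), lowPivot,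
    ← min_add_add_right]
  rfl

theorem pivotQ_toInput {N : ℕ} (σ : Equiv.Perm (Fin (N + 2))) :
    pivotQ (toInput σ) = highPivot σ + 1 := by
  rw [pivotQ, length_toInput, entry_toInput σ (by omega), entry_toInput σ (by omega), highPivot,
    ← max_add_add_right]
  rfl

/-- When `0, …, N + 1` are partitioned by pivots `x < y`, the elements of kind `k` are
`blockStart x y k, …, blockStart x y k + blockLen N x y k - 1`. -/
def blockStart (x y : ℕ) : Kind → ℕ
  | .small => 0
  | .medium => x + 1
  | .large => y + 1

/-- The number of elements of a kind when `0, …, N + 1` are partitioned by pivots `x < y`. -/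
def blockLen (N x y : ℕ) : Kind → ℕ
  | .small => x
  | .medium => y - x - 1
  | .large => N + 1 - y

theorem exists_entry_iff {N : ℕ} (σ : Equiv.Perm (Fin (N + 2))) (k : Kind) (v : ℕ) :
    (∃ i ∈ inner (N + 2), kind (toInput σ) i = k ∧ entry (toInput σ) i = v) ↔
      blockStart (lowPivot σ) (highPivot σ) k + 1 ≤ v ∧
        v < blockStart (lowPivot σ) (highPivot σ) k + 1 +
          blockLen N (lowPivot σ) (highPivot σ) k := by
  have hlt := lowPivot_lt_highPivot σ
  have hhi := highPivot_lt σ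
  -- only the pivots, at the first and the last position, have the values `lowPivot σ` and
  -- `highPivot σ`
  have key : ∀ j : Fin (N + 2), ((j : ℕ) + 1 ∈ inner (N + 2)) ↔
      ((σ j : ℕ) ≠ lowPivot σ ∧ (σ j : ℕ) ≠ highPivot σ) := by
    intro j
    have e0 : (σ j : ℕ) = σ 0 ↔ (j : ℕ) = 0 := by
      rw [Fin.val_inj, σ.injective.eq_iff, Fin.ext_iff]; rfl
    have e1 : (σ j : ℕ) = σ (Fin.last _) ↔ (j : ℕ) = N + 1 := by
      rw [Fin.val_inj, σ.injective.eq_iff, Fin.ext_iff]; rfl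
    have := j.2
    simp only [lowPivot, highPivot, Finset.mem_Icc]
    omega
  constructor
  · rintro ⟨i, hi', hk, rfl⟩
    have hi2 := Finset.mem_Icc.1 hi'
    obtain ⟨j, rfl⟩ : ∃ j : Fin (N + 2), (j : ℕ) + 1 = i := ⟨⟨i - 1, by omega⟩, by simp; omega⟩
    have hj := (key j).1 hi'
    have h3 : entry (toInput σ) (j + 1) = σ j + 1 := by
      rw [entry_toInput σ (by simp)]; simp
    rw [kind, pivotP_toInput, pivotQ_toInput] at hk
    rw [h3] at hk ⊢
    have := (σ j).2
    subst hk
    split_ifs <;> simp only [blockStart, blockLen] <;> omega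
  · rintro ⟨h1, h2⟩
    have hv : v - 1 < N + 2 := by cases k <;> simp only [blockStart, blockLen] at h1 h2 <;> omega
    set j := σ.symm ⟨v - 1, hv⟩ with hj
    have hj' : (σ j : ℕ) = v - 1 := by rw [hj]; simp
    have h3 : entry (toInput σ) (j + 1) = σ j + 1 := by
      rw [entry_toInput σ (by simp)]; simp
    refine ⟨j + 1, (key j).2 ?_, ?_, ?_⟩
    · rw [hj']
      cases k <;> simp only [blockStart, blockLen] at h1 h2 <;> omega
    · rw [kind, pivotP_toInput, pivotQ_toInput, h3, hj']
      cases k <;> simp only [blockStart, blockLen] at h1 h2 <;> split_ifs <;>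
        first | rfl | (exfalso; omega)
    · rw [h3, hj']; omega

theorem entry_toInput_injOn {n : ℕ} (σ : Equiv.Perm (Fin n)) :
    Set.InjOn (entry (toInput σ)) (inner n) := by
  intro i hi j hj h
  have hi := Finset.mem_Icc.1 hi
  have hj := Finset.mem_Icc.1 hj
  rw [entry_toInput σ (by omega), entry_toInput σ (by omega)] at h
  have h2 := σ.injective (Fin.ext (Nat.add_right_cancel h))
  have := Fin.mk.inj h2
  omega

theorem count_kinds_toInput {N : ℕ} (σ : Equiv.Perm (Fin (N + 2))) (k : Kind) :
    (kinds (toInput σ)).count k = blockLen N (lowPivot σ) (highPivot σ) k := by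
  rw [count_kinds, length_toInput, ← Finset.card_image_of_injOn (f := entry (toInput σ))
    ((entry_toInput_injOn σ).mono (by intro i hi; exact (Finset.mem_filter.1 hi).1))]
  have : ((inner (N + 2)).filter fun i => kind (toInput σ) i = k).image (entry (toInput σ)) =
      Finset.Ico (blockStart (lowPivot σ) (highPivot σ) k + 1)
        (blockStart (lowPivot σ) (highPivot σ) k + 1 +
          blockLen N (lowPivot σ) (highPivot σ) k) := by
    ext v
    rw [Finset.mem_Ico, ← exists_entry_iff]
    simp only [Finset.mem_image, Finset.mem_filter, and_assoc]
  rw [this]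
  simp

theorem subarray_perm (A : Arrangement) {N : ℕ} (σ : Equiv.Perm (Fin (N + 2))) (k : Kind) :
    (subarray A (toInput σ) k).Perm
      (List.range' (blockStart (lowPivot σ) (highPivot σ) k + 1)
        (blockLen N (lowPivot σ) (highPivot σ) k)) := by
  refine (List.perm_ext_iff_of_nodup ?_ List.nodup_range').2 fun v => ?_
  · refine (nodup_order A _ k).map_on fun i hi j hj h => entry_toInput_injOn σ ?_ ?_ h
    · simpa using ((mem_order A _ k i).1 hi).1
    · simpa using ((mem_order A _ k j).1 hj).1
  · rw [List.mem_range'_1, ← exists_entry_iff]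
    simp only [subarray, List.mem_map, mem_order, length_toInput, and_assoc]

theorem exists_eq_toInput_map_add {b : List ℕ} {d m : ℕ} (h : b.Perm (List.range' (d + 1) m)) :
    ∃ τ : Equiv.Perm (Fin m), b = (toInput τ).map (· + d) := by
  have hlen : b.length = m := by simpa using h.length_eq
  have hnd : b.Nodup := h.nodup_iff.2 List.nodup_range'
  have hmem : ∀ v ∈ b, d + 1 ≤ v ∧ v < d + 1 + m := fun v hv => by
    simpa [List.mem_range'_1] using h.mem_iff.1 hv
  have hb : ∀ i : Fin m, d + 1 ≤ b[(i : ℕ)] ∧ b[(i : ℕ)] < d + 1 + m := fun i =>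
    hmem _ (List.getElem_mem _)
  let f : Fin m → Fin m := fun i => ⟨b[(i : ℕ)] - d - 1, by have := hb i; omega⟩
  have hf : Function.Injective f := by
    intro i j hij
    have h1 := Fin.mk.inj hij
    have h2 := hb i
    have h3 := hb j
    exact Fin.ext ((hnd.getElem_inj_iff).1 (show b[(i : ℕ)] = b[(j : ℕ)] by omega))
  refine ⟨Equiv.ofBijective f (Finite.injective_iff_bijective.1 hf), ?_⟩
  refine List.ext_getElem (by simp [hlen]) fun i h1 h2 => ?_
  have := hb ⟨i, by omega⟩
  simp only at this
  simp only [toInput, List.getElem_map, List.getElem_ofFn, Equiv.ofBijective_apply, f]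
  omega

theorem blockStart_add_blockLen_le {N x y : ℕ} (h1 : x < y) (h2 : y < N + 2) (k : Kind) :
    blockStart x y k + blockLen N x y k ≤ N + 2 := by
  cases k <;> simp only [blockStart, blockLen] <;> omega

theorem block_separated {N x y u v : ℕ} (h1 : x < y) {k : Kind}
    (hu : u < blockLen N x y k) (hv : v < blockLen N x y k) :
    (blockStart x y k + u < x ↔ blockStart x y k + v < x) ∧
      (y < blockStart x y k + u ↔ y < blockStart x y k + v) := by
  cases k <;> simp only [blockStart, blockLen] at * <;> omega

/-- The embedding of `0, …, m - 1` as the block `d, …, d + m - 1`. -/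
def blockEmbedding {n m : ℕ} (d : ℕ) (h : d + m ≤ n) : Fin m ↪ Fin n :=
  ⟨fun i => ⟨d + i, by omega⟩, fun i j hij => by simpa [Fin.ext_iff] using hij⟩

/-- Acting on the values in one block by a permutation `π`, and fixing all other values. -/
def blockPerm {n m : ℕ} (d : ℕ) (h : d + m ≤ n) (π : Equiv.Perm (Fin m)) : Equiv.Perm (Fin n) :=
  π.viaFintypeEmbedding (blockEmbedding d h)

theorem blockPerm_apply {n m d : ℕ} (h : d + m ≤ n) (π : Equiv.Perm (Fin m)) (i : Fin m)
    {v : Fin n} (hv : (v : ℕ) = d + i) : (blockPerm d h π v : ℕ) = d + π i := by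
  have e : v = blockEmbedding d h i := Fin.ext hv
  rw [e, blockPerm, Equiv.Perm.viaFintypeEmbedding_apply_image]
  rfl

theorem blockPerm_apply_of_not {n m d : ℕ} (h : d + m ≤ n) (π : Equiv.Perm (Fin m)) {v : Fin n}
    (hv : (v : ℕ) < d ∨ d + m ≤ v) : blockPerm d h π v = v := by
  refine Equiv.Perm.viaFintypeEmbedding_apply_notMem_range _ _ ?_
  rintro ⟨i, rfl⟩
  have : (blockEmbedding d h i : ℕ) = d + i := rfl
  omega

section

variable {N : ℕ} (σ : Equiv.Perm (Fin (N + 2))) (k : Kind)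
  (h : blockStart (lowPivot σ) (highPivot σ) k + blockLen N (lowPivot σ) (highPivot σ) k ≤ N + 2)
  (π : Equiv.Perm (Fin (blockLen N (lowPivot σ) (highPivot σ) k)))

theorem blockPerm_pivots : (blockPerm _ h π * σ) 0 = σ 0 ∧
    (blockPerm _ h π * σ) (Fin.last _) = σ (Fin.last _) := by
  have h1 := lowPivot_lt_highPivot σ
  have h2 := highPivot_lt σ
  constructor
  · refine blockPerm_apply_of_not h π ?_
    have : (σ 0 : ℕ) = lowPivot σ ∨ (σ 0 : ℕ) = highPivot σ := by
      simp only [lowPivot, highPivot]; omega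
    cases k <;> simp only [blockStart, blockLen] <;> omega
  · refine blockPerm_apply_of_not h π ?_
    have : (σ (Fin.last _) : ℕ) = lowPivot σ ∨ (σ (Fin.last _) : ℕ) = highPivot σ := by
      simp only [lowPivot, highPivot]; omega
    cases k <;> simp only [blockStart, blockLen] <;> omega

/-- Permuting the values in the block of kind `k` permutes the subarray of kind `k` accordingly. -/
theorem subarray_blockPerm_mul (A : Arrangement)
    {τ : Equiv.Perm (Fin (blockLen N (lowPivot σ) (highPivot σ) k))}
    (hτ : subarray A (toInput σ) k =
      (toInput τ).map (· + blockStart (lowPivot σ) (highPivot σ) k)) :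
    subarray A (toInput (blockPerm _ h π * σ)) k =
      (toInput (π * τ)).map (· + blockStart (lowPivot σ) (highPivot σ) k) := by
  set d := blockStart (lowPivot σ) (highPivot σ) k with hd
  set ρ := blockPerm d h π with hρ
  have hlo : lowPivot (ρ * σ) = lowPivot σ := lowPivot_congr (blockPerm_pivots σ k h π)
  have hhi : highPivot (ρ * σ) = highPivot σ := highPivot_congr (blockPerm_pivots σ k h π)
  let f : ℕ → ℕ := fun v => if hv : v - 1 < N + 2 then ρ ⟨v - 1, hv⟩ + 1 else v
  have hmap : toInput (ρ * σ) = (toInput σ).map f := by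
    simp only [toInput, List.map_ofFn]
    congr 1
    funext i
    simp [f]
  have hlt := lowPivot_lt_highPivot σ
  have hlt' := highPivot_lt σ
  -- the block is mapped to itself and all other values are fixed, so no kind changes
  have hval : ∀ v : Fin (N + 2), ((ρ v : ℕ) < lowPivot σ ↔ (v : ℕ) < lowPivot σ) ∧
      (highPivot σ < (ρ v : ℕ) ↔ highPivot σ < (v : ℕ)) := by
    intro v
    by_cases hv : (v : ℕ) < d ∨ d + blockLen N (lowPivot σ) (highPivot σ) k ≤ v
    · rw [hρ, blockPerm_apply_of_not h π hv]; simp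
    · have e := blockPerm_apply h π ⟨v - d, by omega⟩ (v := v) (by simp only; omega)
      have e2 := block_separated hlt (π ⟨v - d, by omega⟩).2
        (show (v : ℕ) - d < blockLen N (lowPivot σ) (highPivot σ) k by omega)
      rwa [← hd, ← e, ← hρ, show d + (v - d) = (v : ℕ) by omega] at e2
  have hkinds : kinds ((toInput σ).map f) = kinds (toInput σ) := by
    rw [← hmap, kinds, kinds, length_toInput, length_toInput]
    refine List.map_congr_left fun i hi' => ?_
    rw [List.mem_range'_1] at hi'
    simp only [kind, pivotP_toInput, pivotQ_toInput, hlo, hhi]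
    rw [entry_toInput _ (by omega), entry_toInput _ (by omega)]
    simp only [Nat.add_lt_add_iff_right, Equiv.Perm.coe_mul, Function.comp_apply, hval]
  rw [hmap, subarray_map A f k hkinds, hτ]
  simp only [toInput, List.map_ofFn]
  congr 1
  funext i
  have e3 : (τ i : ℕ) + 1 + d - 1 < N + 2 := by omega
  have e := blockPerm_apply h π (τ i) (v := ⟨(τ i : ℕ) + 1 + d - 1, e3⟩) (by simp only; omega)
  rw [← hρ] at e
  simp only [Function.comp_apply, f, e3, dif_pos, e, Equiv.Perm.coe_mul]
  omega

end

/-! ### Inputs with given numbers of small and large elements -/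

/-- The possible pairs `(s, l)` of numbers of small and large elements among `N` elements. -/
def simplex (N : ℕ) : Finset (ℕ × ℕ) :=
  (Finset.range (N + 1) ×ˢ Finset.range (N + 1)).filter fun x => x.1 + x.2 ≤ N

@[simp] theorem mem_simplex {N : ℕ} {x : ℕ × ℕ} : x ∈ simplex N ↔ x.1 + x.2 ≤ N := by
  simp only [simplex, Finset.mem_filter, Finset.mem_product, Finset.mem_range]
  omega

/-- The permutations with `s` small and `l` large elements, as inputs of length `N + 2`. -/
def sample (N s l : ℕ) : Finset (Equiv.Perm (Fin (N + 2))) :=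
  Finset.univ.filter fun σ => numSmall (toInput σ) = s ∧ numLarge (toInput σ) = l

theorem mem_sample {N s l : ℕ} {σ : Equiv.Perm (Fin (N + 2))} :
    σ ∈ sample N s l ↔ lowPivot σ = s ∧ N + 1 - highPivot σ = l := by
  simp only [sample, Finset.mem_filter, Finset.mem_univ, true_and, numSmall, numLarge,
    count_kinds_toInput]
  rfl

theorem mem_sample_iff_highPivot {N s l : ℕ} (h : s + l ≤ N) {σ : Equiv.Perm (Fin (N + 2))} :
    σ ∈ sample N s l ↔ lowPivot σ = s ∧ highPivot σ = N + 1 - l := by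
  rw [mem_sample]
  have := highPivot_lt σ
  omega

theorem sum_perm_eq_sum_simplex {N : ℕ} (f : Equiv.Perm (Fin (N + 2)) → ℝ) :
    ∑ σ, f σ = ∑ x ∈ simplex N, ∑ σ ∈ sample N x.1 x.2, f σ := by
  rw [← Finset.sum_fiberwise_of_maps_to (s := Finset.univ) (t := simplex N)
    (g := fun σ : Equiv.Perm (Fin (N + 2)) => (lowPivot σ, N + 1 - highPivot σ))]
  · refine Finset.sum_congr rfl fun x _ => Finset.sum_congr ?_ fun _ _ => rfl
    ext σ
    rw [mem_sample]
    simp [Prod.ext_iff]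
  · intro σ _
    have h1 := lowPivot_lt_highPivot σ
    have h2 := highPivot_lt σ
    rw [mem_simplex]
    simp only; omega

theorem pivots_of_mem_sample {N s l : ℕ} (h : s + l ≤ N) {σ : Equiv.Perm (Fin (N + 2))} :
    σ ∈ sample N s l ↔
      ((σ 0 : ℕ) = s ∧ (σ (Fin.last _) : ℕ) = N + 1 - l) ∨
      ((σ 0 : ℕ) = N + 1 - l ∧ (σ (Fin.last _) : ℕ) = s) := by
  rw [mem_sample_iff_highPivot h, lowPivot, highPivot]
  omega

/-- All pairs of pivots are equally likely: a permutation of the values carries the inputs with one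
pair of pivots to those with another one. -/
theorem card_sample_le {N s l s' l' : ℕ} (h : s + l ≤ N) (h' : s' + l' ≤ N) :
    (sample N s l).card ≤ (sample N s' l').card := by
  let a : Fin (N + 2) := ⟨s, by omega⟩
  let b : Fin (N + 2) := ⟨N + 1 - l, by omega⟩
  let a' : Fin (N + 2) := ⟨s', by omega⟩
  let b' : Fin (N + 2) := ⟨N + 1 - l', by omega⟩
  have hab : b ≠ a := by simp only [a, b, ne_eq, Fin.mk.injEq]; omega
  have hab' : a' ≠ b' := by simp only [a', b', ne_eq, Fin.mk.injEq]; omega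
  obtain ⟨π, ha, hb⟩ : ∃ π : Equiv.Perm (Fin (N + 2)), π a = a' ∧ π b = b' := by
    refine ⟨Equiv.swap (Equiv.swap a a' b) b' * Equiv.swap a a', ?_, ?_⟩
    · rw [Equiv.Perm.mul_apply, Equiv.swap_apply_left]
      refine Equiv.swap_apply_of_ne_of_ne (fun hc => hab ?_) hab'
      apply (Equiv.swap a a').injective
      rw [← hc, Equiv.swap_apply_left]
    · rw [Equiv.Perm.mul_apply, Equiv.swap_apply_left]
  refine Finset.card_le_card_of_injOn (fun σ => π * σ) (fun σ hσ => ?_)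
    ((mul_right_injective π).injOn)
  have hσ' := (pivots_of_mem_sample h).1 hσ
  refine (pivots_of_mem_sample h').2 ?_
  have e : ∀ i, (σ i : ℕ) = s → ((π * σ) i : ℕ) = s' := fun i hi => by
    rw [Equiv.Perm.mul_apply, show σ i = a from Fin.ext hi, ha]
  have e' : ∀ i, (σ i : ℕ) = N + 1 - l → ((π * σ) i : ℕ) = N + 1 - l' := fun i hi => by
    rw [Equiv.Perm.mul_apply, show σ i = b from Fin.ext hi, hb]
  exact hσ'.imp (fun hc => ⟨e _ hc.1, e' _ hc.2⟩) (fun hc => ⟨e' _ hc.1, e _ hc.2⟩)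

theorem sum_simplex_succ (N : ℕ) (f : ℕ × ℕ → ℝ) : ∑ x ∈ simplex (N + 1), f x =
    ∑ x ∈ simplex N, f x + ∑ x ∈ Finset.HasAntidiagonal.antidiagonal (N + 1), f x := by
  rw [← Finset.sum_union]
  · refine Finset.sum_congr ?_ fun _ _ => rfl
    ext x
    rw [Finset.mem_union, mem_simplex, mem_simplex, Finset.HasAntidiagonal.mem_antidiagonal]
    omega
  · rw [Finset.disjoint_left]
    intro x hx hx'
    rw [mem_simplex] at hx
    rw [Finset.HasAntidiagonal.mem_antidiagonal] at hx'
    omega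

theorem card_simplex (N : ℕ) : ((simplex N).card : ℝ) = (N + 2).choose 2 := by
  induction N with
  | zero => rw [show simplex 0 = {(0, 0)} from rfl]; simp
  | succ N ih =>
    have h := sum_simplex_succ N fun _ => 1
    simp only [Finset.sum_const, nsmul_eq_mul, mul_one, Finset.Nat.card_antidiagonal] at h
    rw [h, ih, Nat.choose_succ_succ' (N + 2) 1, Nat.choose_one_right]
    push_cast; ring

theorem card_sample_mul {N s l : ℕ} (h : s + l ≤ N) :
    ((sample N s l).card : ℝ) * (N + 2).choose 2 = (N + 2).factorial := by
  have h1 := sum_perm_eq_sum_simplex (N := N) fun _ => 1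
  simp only [Finset.sum_const, nsmul_eq_mul, mul_one, Finset.card_univ, Fintype.card_perm,
    Fintype.card_fin] at h1
  rw [h1, Finset.sum_congr rfl fun x hx => congrArg Nat.cast
    (le_antisymm (card_sample_le (mem_simplex.1 hx) h) (card_sample_le h (mem_simplex.1 hx))),
    Finset.sum_const, nsmul_eq_mul, card_simplex, mul_comm]

/-- Given the numbers of small and large elements, all arrangements of the kinds are equally
likely: exchanging two inner positions preserves the pivots. -/
theorem exchangeable_sample (N s l : ℕ) :
    Exchangeable (sample N s l) (fun σ => kind (toInput σ)) (inner (N + 2)) := by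
  intro i hi' j hj'
  have hi := Finset.mem_Icc.1 hi'
  have hj := Finset.mem_Icc.1 hj'
  let i' : Fin (N + 2) := ⟨i - 1, by omega⟩
  let j' : Fin (N + 2) := ⟨j - 1, by omega⟩
  have h0 : Equiv.swap i' j' 0 = 0 := Equiv.swap_apply_of_ne_of_ne
    (by simp only [i', ne_eq, Fin.ext_iff, Fin.val_zero]; omega)
    (by simp only [j', ne_eq, Fin.ext_iff, Fin.val_zero]; omega)
  have h1 : Equiv.swap i' j' (Fin.last _) = Fin.last _ := Equiv.swap_apply_of_ne_of_ne
    (by simp only [i', ne_eq, Fin.ext_iff, Fin.val_last]; omega)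
    (by simp only [j', ne_eq, Fin.ext_iff, Fin.val_last]; omega)
  have hlo : ∀ σ : Equiv.Perm (Fin (N + 2)),
      lowPivot (σ * Equiv.swap i' j') = lowPivot σ := fun σ => by
    simp only [lowPivot, Equiv.Perm.mul_apply, h0, h1]
  have hhi : ∀ σ : Equiv.Perm (Fin (N + 2)), highPivot (σ * Equiv.swap i' j') =
      highPivot σ := fun σ => by
    simp only [highPivot, Equiv.Perm.mul_apply, h0, h1]
  refine ⟨Equiv.mulRight (Equiv.swap i' j'), fun σ => ?_, fun σ _ k => ?_⟩
  · rw [Equiv.coe_mulRight, mem_sample, mem_sample, hlo, hhi]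
  · have he : entry (toInput (σ * Equiv.swap i' j')) k = entry (toInput σ) (Equiv.swap i j k) := by
      by_cases hk : k - 1 < N + 2
      · rw [entry_toInput _ hk, Equiv.Perm.mul_apply]
        by_cases hki : k = i
        · subst hki
          rw [Equiv.swap_apply_left, Equiv.swap_apply_left, entry_toInput σ (by omega)]
        by_cases hkj : k = j
        · subst hkj
          rw [Equiv.swap_apply_right, Equiv.swap_apply_right, entry_toInput σ (by omega)]
        rw [Equiv.swap_apply_of_ne_of_ne hki hkj, entry_toInput σ hk,
          Equiv.swap_apply_of_ne_of_ne]
        · simp only [i', ne_eq, Fin.mk.injEq]; omega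
        · simp only [j', ne_eq, Fin.mk.injEq]; omega
      · rw [Equiv.swap_apply_of_ne_of_ne (by omega) (by omega),
          entry_toInput_of_le _ (by omega), entry_toInput_of_le _ (by omega)]
    simp only [Equiv.coe_mulRight, kind, pivotP_toInput, pivotQ_toInput, hlo, hhi, he]

theorem card_filter_kind {N s l : ℕ} (σ : Equiv.Perm (Fin (N + 2))) (hσ : σ ∈ sample N s l) :
    ((inner (N + 2)).filter fun i => kind (toInput σ) i = .small).card = s ∧
    ((inner (N + 2)).filter fun i => kind (toInput σ) i = .large).card = l := by
  have h1 := count_kinds (toInput σ) .small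
  have h2 := count_kinds (toInput σ) .large
  rw [length_toInput] at h1 h2
  have h := (Finset.mem_filter.1 hσ).2
  exact ⟨h1.symm.trans h.1, h2.symm.trans h.2⟩

theorem card_inner (N : ℕ) : (inner (N + 2)).card = N := by simp

theorem le_sum_sample {N s l : ℕ} (t : DecisionTree (inner (N + 2))) :
    (sample N s l).card * minAdditional N s l ≤
      ∑ σ ∈ sample N s l, (t.additional (kind (toInput σ)) : ℝ) := by
  have := le_sum_additional t (exchangeable_sample N s l) (fun σ hσ => (card_filter_kind σ hσ).1)
    (fun σ hσ => (card_filter_kind σ hσ).2)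
  rw [card_inner] at this
  exact_mod_cast this

theorem sum_sample_eq {S : Strategy} (hS : IsStrategyO S) {N s l : ℕ} (h : s + l ≤ N) :
    ∑ σ ∈ sample N s l, ((S (N + 2) s l).additional (kind (toInput σ)) : ℝ) =
      (sample N s l).card * minAdditional N s l := by
  have := sum_additional_of_followsO (S (N + 2) s l) (hS (N + 2) s l (by omega)) (add_zero s)
    (add_zero l) (exchangeable_sample N s l) (fun σ hσ => (card_filter_kind σ hσ).1)
    (fun σ hσ => (card_filter_kind σ hσ).2)
  rw [card_inner] at this
  exact_mod_cast this

/-- Strategy O has the least additional cost term. -/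
theorem ACT_le {S : Strategy} (hS : IsStrategyO S) {n : ℕ} (hn : 2 ≤ n)
    (T : ℕ → ℕ → DecisionTree (inner n)) : ACT n (S n) ≤ ACT n T := by
  obtain ⟨N, rfl⟩ := Nat.exists_eq_add_of_le' hn
  refine div_le_div_of_nonneg_right (Finset.sum_le_sum fun x hx => ?_) (Nat.cast_nonneg _)
  have hx : x.1 + x.2 ≤ N := (Finset.mem_filter.1 hx).2
  refine div_le_div_of_nonneg_right ?_ (Nat.cast_nonneg _)
  exact (sum_sample_eq hS hx).trans_le (le_sum_sample (T x.1 x.2))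

/-! ### The recurrence for the average number of comparisons -/

theorem sum_quicksort_toInput (S : Strategy) (A : Arrangement) (m : ℕ) :
    ∑ τ : Equiv.Perm (Fin m), ((quicksort S A (toInput τ)).2 : ℝ) =
      m.factorial * expComparisons S A m := by
  rw [expComparisons, mul_div_cancel₀ _ (Nat.cast_ne_zero.2 m.factorial_ne_zero)]

/-- Randomness is preserved in the subarrays: sorting the subarray of kind `k` takes on average
as many comparisons as sorting a random permutation of the same length. Averaging over the action
of all permutations of the values of kind `k` makes this subarray uniformly distributed. -/
theorem sum_subarray (S : Strategy) (A : Arrangement) {N s l : ℕ} (h : s + l ≤ N) (k : Kind) :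
    ∑ σ ∈ sample N s l, ((quicksort S A (subarray A (toInput σ) k)).2 : ℝ) =
      (sample N s l).card * expComparisons S A (blockLen N s (N + 1 - l) k) := by
  set m := blockLen N s (N + 1 - l) k with hm
  set d := blockStart s (N + 1 - l) k with hd
  have hdm : d + m ≤ N + 2 := blockStart_add_blockLen_le (by omega) (by omega) k
  have hτ : ∀ σ ∈ sample N s l, ∃ τ : Equiv.Perm (Fin m), ∀ π : Equiv.Perm (Fin m),
      blockPerm d hdm π * σ ∈ sample N s l ∧
      subarray A (toInput (blockPerm d hdm π * σ)) k = (toInput (π * τ)).map (· + d) := by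
    intro σ hσ
    obtain ⟨h1, h2⟩ := (mem_sample_iff_highPivot h).1 hσ
    rw [← h1, ← h2] at hm hd
    clear_value m d
    subst hm hd
    obtain ⟨τ, hτ⟩ := exists_eq_toInput_map_add (subarray_perm A σ k)
    refine ⟨τ, fun π => ⟨?_, subarray_blockPerm_mul σ k hdm π A hτ⟩⟩
    have h3 := blockPerm_pivots σ k hdm π
    rw [mem_sample] at hσ ⊢
    rwa [lowPivot_congr h3, highPivot_congr h3]
  choose! τ hτ using hτ
  have hinv : ∀ π : Equiv.Perm (Fin m),
      ∑ σ ∈ sample N s l, ((quicksort S A (subarray A (toInput σ) k)).2 : ℝ) =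
      ∑ σ ∈ sample N s l, ((quicksort S A (toInput (π * τ σ))).2 : ℝ) := by
    intro π
    have himg : (sample N s l).map (Equiv.mulLeft (blockPerm d hdm π)).toEmbedding =
        sample N s l := by
      refine Finset.eq_of_subset_of_card_le (fun ρ hρ => ?_) (by simp)
      obtain ⟨σ, hσ, rfl⟩ := Finset.mem_map.1 hρ
      exact (hτ σ hσ π).1
    conv_lhs => rw [← himg]
    rw [Finset.sum_map]
    refine Finset.sum_congr rfl fun σ hσ => ?_
    rw [Equiv.coe_toEmbedding, Equiv.coe_mulLeft, (hτ σ hσ π).2, quicksort_snd_map_add]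
  have hsum := Finset.sum_congr (rfl : (Finset.univ : Finset (Equiv.Perm (Fin m))) = _)
    fun π _ => hinv π
  rw [Finset.sum_const, Finset.card_univ, Fintype.card_perm, Fintype.card_fin, nsmul_eq_mul,
    Finset.sum_comm] at hsum
  have hinner : ∀ σ ∈ sample N s l,
      ∑ π : Equiv.Perm (Fin m), ((quicksort S A (toInput (π * τ σ))).2 : ℝ) =
      m.factorial * expComparisons S A m := fun σ _ => by
    rw [← sum_quicksort_toInput]
    exact Equiv.sum_comp (Equiv.mulRight (τ σ)) fun π => ((quicksort S A (toInput π)).2 : ℝ)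
  rw [Finset.sum_congr rfl hinner, Finset.sum_const, nsmul_eq_mul] at hsum
  refine mul_left_cancel₀ (Nat.cast_ne_zero.2 m.factorial_ne_zero : (m.factorial : ℝ) ≠ 0) ?_
  rw [hsum]; ring

theorem expComparisons_of_le (S : Strategy) (A : Arrangement) {n : ℕ} (hn : n ≤ 1) :
    expComparisons S A n = 0 := by
  simp [expComparisons, quicksort_snd_of_le S A (a := toInput _) (by simpa using hn)]

theorem expComparisons_add_two {S : Strategy} (hS : IsStrategyO S) (A : Arrangement) (N : ℕ) :
    expComparisons S A (N + 2) * (N + 2).choose 2 =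
      ∑ x ∈ simplex N, (1 + N + (N - x.1 - x.2 : ℝ) + minAdditional N x.1 x.2 +
        expComparisons S A x.1 + expComparisons S A (N - x.1 - x.2) + expComparisons S A x.2) := by
  have hfac : ((N + 2).factorial : ℝ) ≠ 0 := Nat.cast_ne_zero.2 (Nat.factorial_ne_zero _)
  refine mul_left_cancel₀ hfac ?_
  rw [← mul_assoc, ← sum_quicksort_toInput, sum_perm_eq_sum_simplex, Finset.sum_mul,
    Finset.mul_sum]
  refine Finset.sum_congr rfl fun x hx => ?_
  have hx := mem_simplex.1 hx
  rw [← card_sample_mul hx]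
  have e1 := sum_subarray S A hx .small
  have e2 := sum_subarray S A hx .medium
  have e3 := sum_subarray S A hx .large
  have e4 := sum_sample_eq hS hx
  simp only [blockLen] at e1 e2 e3
  rw [show N + 1 - x.2 - x.1 - 1 = N - x.1 - x.2 by omega] at e2
  rw [show N + 1 - (N + 1 - x.2) = x.2 by omega] at e3
  have hσ : ∀ σ ∈ sample N x.1 x.2, ((quicksort S A (toInput σ)).2 : ℝ) =
      (1 + N + (N - x.1 - x.2 : ℝ)) + ((S (N + 2) x.1 x.2).additional (kind (toInput σ)) : ℝ) +
      (quicksort S A (subarray A (toInput σ) .small)).2 +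
      (quicksort S A (subarray A (toInput σ) .medium)).2 +
      (quicksort S A (subarray A (toInput σ) .large)).2 := by
    intro σ hσ
    have hmem := (Finset.mem_filter.1 hσ).2
    have hmed : (kinds (toInput σ)).count .medium = N - x.1 - x.2 := by
      obtain ⟨h1, h2⟩ := (mem_sample_iff_highPivot hx).1 hσ
      rw [count_kinds_toInput, h1, h2, blockLen]
      omega
    rw [quicksort_snd S A (by simp), partitionCost_eq S (length_toInput σ), hmem.1, hmem.2,
      card_inner, hmed, Nat.sub_sub]
    push_cast [Nat.cast_sub hx]
    ring
  rw [Finset.sum_congr rfl hσ]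
  simp only [Finset.sum_add_distrib, e1, e2, e3, e4, Finset.sum_const, nsmul_eq_mul]
  ring

/-! ### The additional cost term of Strategy O -/

theorem sum_simplex_shift_left {N : ℕ} {f : ℕ × ℕ → ℝ} (hf : ∀ l, f (0, l) = 0) :
    ∑ x ∈ simplex (N + 1), f x = ∑ x ∈ simplex N, f (x.1 + 1, x.2) := by
  symm
  refine Finset.sum_of_injOn (fun x : ℕ × ℕ => (x.1 + 1, x.2)) ?_ ?_ ?_ fun _ _ => rfl
  · intro x _ y _ h
    simpa [Prod.ext_iff] using h
  · intro x hx
    simp only [Finset.mem_coe, mem_simplex] at hx ⊢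
    omega
  · rintro ⟨s, l⟩ hx hn
    cases s with
    | zero => exact hf l
    | succ s =>
      refine absurd ⟨(s, l), ?_, rfl⟩ hn
      simp only [Finset.mem_coe, mem_simplex] at hx ⊢
      omega

theorem sum_simplex_swap (N : ℕ) (f : ℕ × ℕ → ℝ) :
    ∑ x ∈ simplex N, f x.swap = ∑ x ∈ simplex N, f x := by
  refine Finset.sum_nbij' Prod.swap Prod.swap ?_ ?_ (by simp) (by simp) (by simp) <;>
  · intro x hx
    simp only [mem_simplex, Prod.fst_swap, Prod.snd_swap] at hx ⊢
    omega

theorem sum_simplex_shift_right {N : ℕ} {f : ℕ × ℕ → ℝ} (hf : ∀ s, f (s, 0) = 0) :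
    ∑ x ∈ simplex (N + 1), f x = ∑ x ∈ simplex N, f (x.1, x.2 + 1) := by
  rw [← sum_simplex_swap, sum_simplex_shift_left (f := fun x => f x.swap) hf,
    ← sum_simplex_swap N]
  rfl

theorem cast_choose_two (N : ℕ) : ((N + 2).choose 2 : ℝ) = (N + 1) * (N + 2) / 2 := by
  rw [Nat.cast_choose_two]
  push_cast; ring

/-- The sum of `min s l` over all numbers `s` and `l` of small and large elements. -/
noncomputable def sumMin (N : ℕ) : ℝ := ∑ x ∈ simplex N, min (x.1 : ℝ) x.2

/-- Removing one small and one large element lowers the minimum by one. -/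
theorem sumMin_add_two (N : ℕ) : sumMin (N + 2) = sumMin N + (N + 1) * (N + 2) / 2 := by
  rw [sumMin, sum_simplex_shift_left (by simp), sum_simplex_shift_right, sumMin]
  · have : ∀ x : ℕ × ℕ, min (((x.1 + 1 : ℕ) : ℝ)) ((x.2 + 1 : ℕ) : ℝ) =
        min (x.1 : ℝ) x.2 + 1 := fun x => by
      push_cast; exact min_add_add_right ..
    simp only [this, Finset.sum_add_distrib, Finset.sum_const, nsmul_eq_mul, mul_one,
      card_simplex, cast_choose_two]
  · intro s
    simp only [Nat.cast_zero, min_eq_right_iff]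
    positivity

theorem sumMin_bounds (N : ℕ) :
    (N * (N + 1) * (N + 2) / 12 - (N + 1) ^ 2 / 8 : ℝ) ≤ sumMin N ∧
      sumMin N ≤ N * (N + 1) * (N + 2) / 12 := by
  induction N using Nat.twoStepInduction with
  | zero =>
    have : sumMin 0 = 0 := by rw [sumMin, show simplex 0 = {(0, 0)} from rfl]; simp
    rw [this]; norm_num
  | one =>
    have : sumMin 1 = 0 := by
      rw [sumMin, show simplex 1 = {(0, 0), (0, 1), (1, 0)} from rfl]; simp
    rw [this]; norm_num
  | more N ih _ =>
    -- the lower bound grows exactly as `sumMin` does, the upper bound by `(N + 2) / 2` more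
    rw [sumMin_add_two]
    push_cast
    have : (0 : ℝ) ≤ N := Nat.cast_nonneg N
    constructor <;> nlinarith [ih.1, ih.2]

/-- The sum of the minimal expected numbers of additional comparisons over all `s` and `l`. -/
noncomputable def sumAdditional (N : ℕ) : ℝ := ∑ x ∈ simplex N, minAdditional N x.1 x.2

/-- If all pairs `(s, l)` are equally likely, then they are still equally likely for the elements
that remain after one step; hence the sums for `N + 1` and for `N` elements differ by one
explicit term. -/
theorem sumAdditional_succ (N : ℕ) :
    (N + 1) * sumAdditional (N + 1) = sumMin (N + 1) + (N + 3) * sumAdditional N := by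
  have hN : (N : ℝ) + 1 ≠ 0 := by positivity
  have h1 : ∑ x ∈ simplex (N + 1), (x.1 : ℝ) * minAdditional N (x.1 - 1) x.2 =
      ∑ x ∈ simplex N, ((x.1 : ℝ) + 1) * minAdditional N x.1 x.2 := by
    rw [sum_simplex_shift_left (by simp)]
    simp
  have h2 : ∑ x ∈ simplex (N + 1), (x.2 : ℝ) * minAdditional N x.1 (x.2 - 1) =
      ∑ x ∈ simplex N, ((x.2 : ℝ) + 1) * minAdditional N x.1 x.2 := by
    rw [sum_simplex_shift_right (by simp)]
    simp
  have h3 : ∑ x ∈ simplex (N + 1), ((N : ℝ) + 1 - x.1 - x.2) * minAdditional N x.1 x.2 =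
      ∑ x ∈ simplex N, ((N : ℝ) + 1 - x.1 - x.2) * minAdditional N x.1 x.2 := by
    rw [sum_simplex_succ, Finset.sum_eq_zero (s := Finset.HasAntidiagonal.antidiagonal _), add_zero]
    intro x hx
    rw [Finset.HasAntidiagonal.mem_antidiagonal] at hx
    have : (x.1 : ℝ) + x.2 = N + 1 := by exact_mod_cast hx
    rw [show (N : ℝ) + 1 - x.1 - x.2 = 0 by linarith, zero_mul]
  rw [sumAdditional, Finset.mul_sum]
  simp only [minAdditional, mul_div_cancel₀ _ hN, Finset.sum_add_distrib, h1, h2, h3]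
  rw [← sumMin, add_assoc, add_assoc, ← Finset.sum_add_distrib, ← Finset.sum_add_distrib,
    sumAdditional, Finset.mul_sum]
  congr 1
  exact Finset.sum_congr rfl fun x _ => by ring

theorem harmonic_succ_real (n : ℕ) : (harmonic (n + 1) : ℝ) = harmonic n + 1 / (n + 1) := by
  rw [harmonic_succ]; push_cast; ring

theorem sumAdditional_bounds (N : ℕ) :
    ((N + 1) * (N + 2) / 2 * (N / 6 - harmonic N / 4) : ℝ) ≤ sumAdditional N ∧
      sumAdditional N ≤ (N + 1) * (N + 2) / 2 * (N / 6) := by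
  induction N with
  | zero => simp [sumAdditional, minAdditional]
  | succ N ih =>
    obtain ⟨h1, h2⟩ := sumMin_bounds (N + 1)
    have h3 := sumAdditional_succ N
    have hN : (0 : ℝ) < N + 1 := by positivity
    have e1 := mul_le_mul_of_nonneg_left ih.1 (show (0 : ℝ) ≤ N + 3 by positivity)
    have e2 := mul_le_mul_of_nonneg_left ih.2 (show (0 : ℝ) ≤ N + 3 by positivity)
    rw [harmonic_succ_real]
    push_cast at h1 h2 ⊢
    constructor <;> refine le_of_mul_le_mul_left ?_ hN
    · rw [h3]
      refine le_trans ?_ (add_le_add h1 e1)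
      rw [← sub_nonneg]
      have : (0 : ℝ) ≤ (N + 2) / 8 := by positivity
      refine this.trans_eq ?_
      field_simp
      ring
    · rw [h3]
      refine (add_le_add h2 e2).trans (le_of_eq ?_)
      ring

/-! ### Solving the recurrence -/

theorem sum_simplex_fst_succ (N : ℕ) (f : ℕ → ℝ) : ∑ x ∈ simplex (N + 1), f x.1 =
    ∑ x ∈ simplex N, f x.1 + ∑ k ∈ Finset.range (N + 2), f k := by
  rw [sum_simplex_succ, Finset.Nat.sum_antidiagonal_eq_sum_range_succ_mk]

theorem sum_simplex_snd (N : ℕ) (f : ℕ → ℝ) :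
    ∑ x ∈ simplex N, f x.2 = ∑ x ∈ simplex N, f x.1 :=
  sum_simplex_swap N fun x => f x.1

theorem sum_simplex_medium (N : ℕ) (f : ℕ → ℝ) :
    ∑ x ∈ simplex N, f (N - x.1 - x.2) = ∑ x ∈ simplex N, f x.1 := by
  refine Finset.sum_nbij' (fun x => (N - x.1 - x.2, x.2)) (fun x => (N - x.1 - x.2, x.2))
    ?_ ?_ ?_ ?_ (fun _ _ => rfl) <;>
  · rintro ⟨s, l⟩ hx
    simp only [mem_simplex, Prod.mk.injEq, and_true] at hx ⊢
    omega

theorem sum_range_harmonic (m : ℕ) :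
    ∑ k ∈ Finset.range m, (harmonic k : ℝ) = m * harmonic m - m := by
  induction m with
  | zero => simp
  | succ m ih =>
    rw [Finset.sum_range_succ, ih, harmonic_succ_real]
    push_cast
    field_simp
    ring

theorem sum_range_mul_harmonic (m : ℕ) : ∑ k ∈ Finset.range m, (k * harmonic k : ℝ) =
    m * (m - 1) / 2 * (harmonic m - 1 / 2) := by
  induction m with
  | zero => simp
  | succ m ih =>
    rw [Finset.sum_range_succ, ih, harmonic_succ_real]
    push_cast
    field_simp
    ring

theorem sum_range_cast (m : ℕ) : ∑ k ∈ Finset.range m, (k : ℝ) = m * (m - 1) / 2 := by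
  induction m with
  | zero => simp
  | succ m ih =>
    rw [Finset.sum_range_succ, ih]
    push_cast
    ring

theorem sum_simplex_harmonic (N : ℕ) : ∑ x ∈ simplex N, (harmonic x.1 : ℝ) =
    (N + 1) * (N + 2) / 2 * (harmonic (N + 2) - 3 / 2) := by
  induction N with
  | zero =>
    rw [show simplex 0 = {(0, 0)} from rfl, Finset.sum_singleton, harmonic_succ_real,
      harmonic_succ_real]
    norm_num
  | succ N ih =>
    rw [sum_simplex_fst_succ N fun k => (harmonic k : ℝ), ih, sum_range_harmonic,
      harmonic_succ_real (N + 2)]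
    push_cast
    field_simp
    ring

theorem sum_simplex_mul_harmonic (N : ℕ) : ∑ x ∈ simplex N, (x.1 * harmonic x.1 : ℝ) =
    N * (N + 1) * (N + 2) / 6 * (harmonic (N + 2) - 5 / 6) := by
  induction N with
  | zero => rw [show simplex 0 = {(0, 0)} from rfl, Finset.sum_singleton]; simp
  | succ N ih =>
    rw [sum_simplex_fst_succ N fun k => (k * harmonic k : ℝ), ih, sum_range_mul_harmonic,
      harmonic_succ_real (N + 2)]
    push_cast
    field_simp
    ring

theorem sum_simplex_fst (N : ℕ) :
    ∑ x ∈ simplex N, (x.1 : ℝ) = N * (N + 1) * (N + 2) / 6 := by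
  induction N with
  | zero => rw [show simplex 0 = {(0, 0)} from rfl, Finset.sum_singleton]; simp
  | succ N ih =>
    rw [sum_simplex_fst_succ N fun k => (k : ℝ), ih, sum_range_cast]
    push_cast
    ring

/-- A comparison principle for the recurrence of dual pivot quicksort: a subsolution that starts
below a supersolution stays below it. -/
theorem le_of_recurrence {a b t : ℕ → ℝ} (h0 : a 0 ≤ b 0) (h1 : a 1 ≤ b 1)
    (ha : ∀ N : ℕ, a (N + 2) * ((N + 1) * (N + 2) / 2) ≤ t N + 3 * ∑ x ∈ simplex N, a x.1)
    (hb : ∀ N : ℕ, t N + 3 * ∑ x ∈ simplex N, b x.1 ≤ b (N + 2) * ((N + 1) * (N + 2) / 2))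
    (n : ℕ) : a n ≤ b n := by
  induction n using Nat.strong_induction_on with
  | _ n ih =>
    match n, ih with
    | 0, _ => exact h0
    | 1, _ => exact h1
    | N + 2, ih =>
      have hN : (0 : ℝ) < (N + 1) * (N + 2) / 2 := by positivity
      have : ∑ x ∈ simplex N, a x.1 ≤ ∑ x ∈ simplex N, b x.1 :=
        Finset.sum_le_sum fun x hx => ih _ (by have := mem_simplex.1 hx; omega)
      exact le_of_mul_le_mul_right (by linarith [ha N, hb N]) hN

/-- The contribution of the first partitioning step to the recurrence, summed over all numbers of
small and large elements. -/
noncomputable def toll (N : ℕ) : ℝ :=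
  (N + 1) * ((N + 1) * (N + 2) / 2) + N * (N + 1) * (N + 2) / 6 + sumAdditional N

theorem expComparisons_recurrence {S : Strategy} (hS : IsStrategyO S) (A : Arrangement) (N : ℕ) :
    expComparisons S A (N + 2) * ((N + 1) * (N + 2) / 2) =
      toll N + 3 * ∑ x ∈ simplex N, expComparisons S A x.1 := by
  have h := expComparisons_add_two hS A N
  have hm : ∑ x ∈ simplex N, (N - x.1 - x.2 : ℝ) = N * (N + 1) * (N + 2) / 6 := by
    rw [← sum_simplex_fst, ← sum_simplex_medium N fun k => (k : ℝ)]
    refine Finset.sum_congr rfl fun x hx => ?_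
    have := mem_simplex.1 hx
    rw [Nat.sub_sub, Nat.cast_sub this]
    push_cast; ring
  rw [cast_choose_two] at h
  simp only [Finset.sum_add_distrib, hm, Finset.sum_const, nsmul_eq_mul, card_simplex,
    cast_choose_two, sum_simplex_snd N (expComparisons S A),
    sum_simplex_medium N (expComparisons S A)] at h
  rw [h, toll, sumAdditional]
  ring

/-- The function on the right satisfies the recurrence with a larger toll, which also has the
leading term `3 / 2 * n` per call. -/
theorem expComparisons_le {S : Strategy} (hS : IsStrategyO S) (A : Arrangement) (n : ℕ) :
    expComparisons S A n ≤ 9 / 5 * (n * harmonic n + harmonic n) := by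
  refine le_of_recurrence (b := fun n => 9 / 5 * (n * harmonic n + harmonic n : ℝ)) (t := toll)
    ?_ ?_ (fun N => (expComparisons_recurrence hS A N).le) (fun N => ?_) n
  · simp [expComparisons_of_le S A zero_le_one]
  · rw [expComparisons_of_le S A le_rfl]
    simp
  · have h := (sumAdditional_bounds N).2
    rw [← Finset.mul_sum, Finset.sum_add_distrib, sum_simplex_harmonic, sum_simplex_mul_harmonic,
      toll]
    have : (0 : ℝ) ≤ (N + 1) * (N + 2) / 2 := by positivity
    push_cast
    linarith

/-- Subtracting `4 * n` lowers the toll per call by a constant, adding `harmonic n / 8` lowers it by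
`harmonic n / 4` up to a constant, which makes up for the logarithmic error in
`sumAdditional_bounds`. -/
theorem le_expComparisons {S : Strategy} (hS : IsStrategyO S) (A : Arrangement) (n : ℕ) :
    9 / 5 * (n * harmonic n + harmonic n) - 4 * n + 1 / 8 * harmonic n ≤ expComparisons S A n := by
  refine le_of_recurrence
    (a := fun n => (9 / 5 * (n * harmonic n + harmonic n) - 4 * n + 1 / 8 * harmonic n : ℝ))
    (t := toll) ?_ ?_ (fun N => ?_) (fun N => (expComparisons_recurrence hS A N).ge) n
  · simp [expComparisons_of_le S A zero_le_one]
  · rw [expComparisons_of_le S A le_rfl]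
    simp
    norm_num
  · have h := (sumAdditional_bounds N).1
    rw [Finset.sum_add_distrib, Finset.sum_sub_distrib, ← Finset.mul_sum, ← Finset.mul_sum,
      ← Finset.mul_sum, Finset.sum_add_distrib, sum_simplex_harmonic, sum_simplex_mul_harmonic,
      sum_simplex_fst, toll]
    have hC : (0 : ℝ) ≤ (N + 1) * (N + 2) / 2 := by positivity
    have hH : (harmonic N : ℝ) ≤ harmonic (N + 2) := by
      rw [harmonic_succ_real, harmonic_succ_real]
      have : (0 : ℝ) ≤ 1 / (N + 1) + 1 / (((N + 1 : ℕ) : ℝ) + 1) := by positivity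
      linarith
    have := mul_le_mul_of_nonneg_left hH hC
    push_cast
    linarith

theorem abs_expComparisons_sub_le {S : Strategy} (hS : IsStrategyO S) (A : Arrangement) {n : ℕ}
    (hn : 1 ≤ n) : |expComparisons S A n - 1.8 * (n : ℝ) * Real.log n| ≤ 4 * n := by
  have hn' : (1 : ℝ) ≤ n := by exact_mod_cast hn
  have h1 := expComparisons_le hS A n
  have h2 := le_expComparisons hS A n
  have h3 : (harmonic n : ℝ) ≤ 1 + Real.log n := harmonic_le_one_add_log n
  have h4 : Real.log n ≤ harmonic n :=
    (Real.log_le_log (by linarith) (by push_cast; linarith)).trans (log_add_one_le_harmonic n)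
  have h5 : Real.log n ≤ n - 1 := Real.log_le_sub_one_of_pos (by linarith)
  have h6 : 0 ≤ Real.log n := Real.log_nonneg hn'
  have h7 := mul_le_mul_of_nonneg_left h3 (show (0 : ℝ) ≤ n by linarith)
  have h8 := mul_le_mul_of_nonneg_left h4 (show (0 : ℝ) ≤ n by linarith)
  norm_num at h1 h2 ⊢
  rw [abs_le]
  constructor <;> linarith
end DualPivot

theorem mainTheorem1 :
    -- Strategy O exists,
    (∃ S : DualPivot.Strategy, DualPivot.IsStrategyO S) ∧
    -- its additional cost term is at most that of every single decision tree,
    (∀ S : DualPivot.Strategy, DualPivot.IsStrategyO S → ∀ n : ℕ, 2 ≤ n →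
      ∀ T : DualPivot.DecisionTree (DualPivot.inner n),
        DualPivot.ACT n (S n) ≤ DualPivot.ACT n (fun _ _ => T)) ∧
    -- and even at most that of every choice of trees depending on `s` and `ℓ`,
    (∀ S : DualPivot.Strategy, DualPivot.IsStrategyO S → ∀ n : ℕ, 2 ≤ n →
      ∀ T : ℕ → ℕ → DualPivot.DecisionTree (DualPivot.inner n),
        DualPivot.ACT n (S n) ≤ DualPivot.ACT n T) ∧
    -- and dual pivot quicksort with Strategy O makes `1.8 n ln n + O(n)` comparisons on average.
    (∃ K : ℝ, ∀ S : DualPivot.Strategy, DualPivot.IsStrategyO S →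
      ∀ (A : DualPivot.Arrangement) (n : ℕ), 1 ≤ n →
        |DualPivot.expComparisons S A n - 1.8 * (n : ℝ) * Real.log (n : ℝ)| ≤ K * (n : ℝ)) :=
  ⟨DualPivot.exists_isStrategyO, fun _ hS _ hn _ => DualPivot.ACT_le hS hn _,
    fun _ hS _ hn T => DualPivot.ACT_le hS hn T,
    4, fun _ hS A _ hn => DualPivot.abs_expComparisons_sub_le hS A hn⟩
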